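/- A network consists of a finite digraph without loops and parallel arcs, two distinct vertices $s$ (the source) and $t$ (the sink), and a finite capacity $c(e)\ge 0$ for each arc $e$. A flow is a function $f$ on the arcs with $0\le f(e)\le c(e)$ for every arc $e$ that is conserved at every vertex other than $s$ and $t$. An augmenting path for $f$ is a path from $s$ to $t$ with distinct vertices, each of whose steps either traverses an arc $e$ with $f(e)<c(e)$ forwards or traverses an arc $e$ with $f(e)>0$ backwards. Pushing as much flow as possible along it adds $x$ to $f$ on its forward arcs and $-x$ on its backward arcs, where $x>0$ is the minimum of the numbers $c(e)-f(e)$ over its forward arcs and $f(e)$ over its backward arcs. A run of the (transfinite) Ford-Fulkerson algorithm on a network assigns a flow $f_\alpha$ to every ordinal $\alpha$, as follows. The initial flow $f_0$ is any flow. For every ordinal $\beta$, if $f_\beta$ has an augmenting path, then one such path is chosen arbitrarily and $f_{\beta+1}$ is obtained from $f_\beta$ by pushing as much flow as possible along it; otherwise $f_{\beta+1}=f_\beta$. If $\alpha$ is a limit ordinal, then $f_\alpha(e)=f_0(e)+\sum_{\beta<\alpha}\bigl(f_{\beta+1}(e)-f_\beta(e)\bigr)$ for each arc $e$, where the sum converges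 absolutely. The run-time of a run is the least ordinal $\alpha$ with $f_\alpha=f_{\alpha+1}$. **Theorem.** For every integer $\ell\ge 1$ there exist a network $N(\ell)$ with exactly $\ell$ arcs and a run of the Ford-Fulkerson algorithm on $N(\ell)$ whose run-time is at least $\omega^{\lfloor \ell/25\rfloor}$. -/

import Mathlib

open scoped Ordinal

noncomputable section

/-- A network with vertex set `V` and arc set `E`: a digraph without loops and parallel arcs (so
that an arc is determined by its ordered pair of end vertices), two distinct vertices, the source
`s` and the sink `t`, and a non-negative real capacity for each arc. -/
structure Network (V E : Type*) where
  src : E → V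
  dst : E → V
  simple : Function.Injective fun e => (src e, dst e)
  loopless : ∀ e, src e ≠ dst e
  s : V
  t : V
  s_ne_t : s ≠ t
  cap : E → ℝ
  cap_nonneg : ∀ e, 0 ≤ cap e

namespace Network

variable {V E : Type*}

open Classical in
/-- `f` is a (valid) flow: it respects the capacities and is conserved at every vertex other than
the source and the sink. -/
structure IsFlow [Fintype E] (N : Network V E) (f : E → ℝ) : Prop where
  nonneg : ∀ e, 0 ≤ f e
  le_cap : ∀ e, f e ≤ N.cap e
  conserved : ∀ u, u ≠ N.s → u ≠ N.t →
    ∑ e with N.dst e = u, f e = ∑ e with N.src e = u, f e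

/-- The vertex at which a step starts. A step `(e, true)` uses the arc `e` as a forward arc, a step
`(e, false)` uses it as a backward arc. -/
def stepStart (N : Network V E) (p : E × Bool) : V :=
  if p.2 then N.src p.1 else N.dst p.1

/-- The vertex at which a step ends. -/
def stepEnd (N : Network V E) (p : E × Bool) : V :=
  if p.2 then N.dst p.1 else N.src p.1

/-- The list `P` of steps leads from `u` to `v`. -/
def IsWalk (N : Network V E) : V → List (E × Bool) → V → Prop
  | u, [], v => u = v
  | u, p :: P, v => N.stepStart p = u ∧ N.IsWalk (N.stepEnd p) P v

/-- The list `P` of steps is a path from `u` to `v`: no vertex is visited twice. -/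
def IsPath (N : Network V E) (u : V) (P : List (E × Bool)) (v : V) : Prop :=
  N.IsWalk u P v ∧ (u :: P.map N.stepEnd).Nodup

/-- How much additional flow a step can carry: the unused capacity of a forward arc, the present
flow of a backward arc. -/
def residual (N : Network V E) (f : E → ℝ) (p : E × Bool) : ℝ :=
  if p.2 then N.cap p.1 - f p.1 else f p.1

/-- `P` is an augmenting path for `f`. -/
def IsAugmenting (N : Network V E) (f : E → ℝ) (P : List (E × Bool)) : Prop :=
  N.IsPath N.s P N.t ∧ ∀ p ∈ P, 0 < N.residual f p

/-- The largest amount of flow that can be pushed along `P`: the minimum of the residuals of its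
steps (an augmenting path has at least one step, as the source is not the sink). -/
def bottleneck (N : Network V E) (f : E → ℝ) (P : List (E × Bool)) : ℝ :=
  sInf (N.residual f '' {p | p ∈ P})

open Classical in
/-- `1` on the forward arcs of `P`, `-1` on the backward arcs of `P`, and `0` on all other arcs. -/
def pathSign (P : List (E × Bool)) (e : E) : ℝ :=
  if (e, true) ∈ P then 1 else if (e, false) ∈ P then -1 else 0

/-- The change of the flow `f` in one step of the algorithm: as much flow as possible is pushed
along the chosen augmenting path; nothing changes if no path is chosen. -/
def change (N : Network V E) (f : E → ℝ) : Option (List (E × Bool)) → E → ℝ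
  | none, _ => 0
  | some P, e => pathSign P e * N.bottleneck f P

/-- An admissible choice at the flow `f`: an augmenting path for `f`, or `none` if there is no
augmenting path. -/
def IsChoice (N : Network V E) (f : E → ℝ) : Option (List (E × Bool)) → Prop
  | none => ∀ P, ¬ N.IsAugmenting f P
  | some P => N.IsAugmenting f P

/-- A run of the transfinite Ford-Fulkerson algorithm: `flow α` is the flow after step `α`, and
`path β` is the augmenting path chosen for `flow β`, which is used in step `β + 1`. The initial
flow is any valid flow. At a limit ordinal `α`, the flow on `e` is the initial flow on `e` plus the
(unconditionally convergent) sum of the changes made on `e` in all earlier steps. -/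
structure Run [Fintype E] (N : Network V E) where
  flow : Ordinal.{0} → E → ℝ
  path : Ordinal.{0} → Option (List (E × Bool))
  isFlow_zero : N.IsFlow (flow 0)
  isChoice : ∀ β, N.IsChoice (flow β) (path β)
  flow_succ : ∀ β e, flow (Order.succ β) e = flow β e + N.change (flow β) (path β) e
  flow_limit : ∀ α, Order.IsSuccLimit α → ∀ e,
    HasSum (fun β : Set.Iio α => N.change (flow β) (path β) e) (flow α e - flow 0 e)

/-- `τ` is the run-time of the run: the least ordinal `α` whose flow equals the flow after the next
step. -/
def Run.IsRunTime [Fintype E] {N : Network V E} (R : N.Run) (τ : Ordinal.{0}) : Prop :=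
  IsLeast {α | R.flow α = R.flow (Order.succ α)} τ

end Network

end

/-! Let r > 0 satisfy r² = 1 - r. Three arcs with flows 0, rY, r²Y support a Euclidean algorithm
that never stops. An augmenting path using the empty arc forwards and the other two backwards pushes
r²Y, leaving r²Y, r³Y, 0; a second one through the newly emptied arc pushes r³Y, leaving r⁴Y, 0,
r³Y. This is the old pattern, permuted, with r²Y in place of Y. Stack k such levels so that each
path also uses an arc of the next lower level forwards. Two pushes then leave r²Y and r³Y on two
arcs of that level, which is thus loaded with rY. If exhausting the lower levels takes L steps, one
round takes 2 + L steps and exhausting one level more takes (2 + L)·ω; hence the power ω^k. The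
increase on any arc is bounded by kY (`Tower.exhausts`), so finite capacities never interfere, and
at the end a direct arc from source to sink can still be augmented. The transfinite run follows a
strategy that sees only the current flow. Each step raises the net outflow of the source by the
amount pushed; as this outflow is bounded, all sums converge
(`summable_iterAmount_and_respectsCap`). Segments of the run compose (`iterFlow_add`), which permits
recursion over the levels. -/

namespace Network

open Filter Topology

/-! ### A single augmentation and the value of the flow -/

section Augmentation

variable {V E : Type*}

/-- `f` satisfies the capacity constraints. -/
def RespectsCap (N : Network V E) (f : E → ℝ) : Prop := ∀ e, 0 ≤ f e ∧ f e ≤ N.cap e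

/-- The amount by which the value of the flow grows in one step of the algorithm. -/
noncomputable def amount (N : Network V E) (f : E → ℝ) : Option (List (E × Bool)) → ℝ
  | none => 0
  | some P => N.bottleneck f P

theorem residual_image_finite (N : Network V E) (f : E → ℝ) (P : List (E × Bool)) :
    (N.residual f '' {p | p ∈ P}).Finite :=
  (List.finite_toSet P).image _

theorem bottleneck_le (N : Network V E) (f : E → ℝ) {P : List (E × Bool)} {p : E × Bool}
    (hp : p ∈ P) : N.bottleneck f P ≤ N.residual f p :=
  csInf_le (N.residual_image_finite f P).bddBelow ⟨p, hp, rfl⟩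

theorem IsAugmenting.ne_nil {N : Network V E} {f : E → ℝ} {P : List (E × Bool)}
    (h : N.IsAugmenting f P) : P ≠ [] := by
  rintro rfl
  exact N.s_ne_t h.1.1

theorem IsAugmenting.bottleneck_pos {N : Network V E} {f : E → ℝ} {P : List (E × Bool)}
    (h : N.IsAugmenting f P) : 0 < N.bottleneck f P := by
  obtain ⟨p, hp⟩ := List.exists_mem_of_ne_nil P h.ne_nil
  have hne : (N.residual f '' {p | p ∈ P}).Nonempty := ⟨_, p, hp, rfl⟩
  obtain ⟨q, hq, hqe⟩ := hne.csInf_mem (N.residual_image_finite f P)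
  have := h.2 q hq
  rw [hqe] at this
  exact this

theorem amount_nonneg {N : Network V E} {f : E → ℝ} {o : Option (List (E × Bool))}
    (h : N.IsChoice f o) : 0 ≤ N.amount f o := by
  cases o with
  | none => exact le_rfl
  | some P => exact (IsAugmenting.bottleneck_pos h).le

theorem abs_pathSign_le (P : List (E × Bool)) (e : E) : |pathSign P e| ≤ 1 := by
  unfold pathSign
  split_ifs <;> simp

theorem abs_change_le {N : Network V E} {f : E → ℝ} {o : Option (List (E × Bool))}
    (h : N.IsChoice f o) (e : E) : |N.change f o e| ≤ N.amount f o := by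
  cases o with
  | none => simp [change, amount]
  | some P =>
    have hb : 0 < N.bottleneck f P := IsAugmenting.bottleneck_pos h
    simp only [change, amount, abs_mul, abs_of_pos hb]
    exact mul_le_of_le_one_left hb.le (abs_pathSign_le P e)

theorem RespectsCap.add_change {N : Network V E} {f : E → ℝ} (hf : N.RespectsCap f)
    {o : Option (List (E × Bool))} (h : N.IsChoice f o) :
    N.RespectsCap (fun e => f e + N.change f o e) := by
  intro e
  have hfe := hf e
  cases o with
  | none => simpa [change] using hfe
  | some P =>
    have hb : 0 < N.bottleneck f P := IsAugmenting.bottleneck_pos h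
    simp only [change, pathSign]
    split_ifs with h1 h2
    · have := N.bottleneck_le f h1
      simp only [residual, if_true] at this
      constructor <;> linarith
    · have := N.bottleneck_le f h2
      simp only [residual, Bool.false_eq_true, if_false] at this
      constructor <;> linarith
    · simpa using hfe

theorem IsWalk.stepStart_mem {N : Network V E} {P : List (E × Bool)} {u v : V}
    (h : N.IsWalk u P v) {p : E × Bool} (hp : p ∈ P) : N.stepStart p ∈ u :: P.map N.stepEnd := by
  induction P generalizing u with
  | nil => simp at hp
  | cons q P ih =>
    rcases List.mem_cons.1 hp with rfl | hp
    · simp [h.1]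
    · exact List.mem_cons_of_mem _ (ih h.2 hp)

open Classical in
/-- The coefficient of an arc in the net outflow of the source. -/
noncomputable def sourceCoeff (N : Network V E) (e : E) : ℝ :=
  (if N.src e = N.s then 1 else 0) - (if N.dst e = N.s then 1 else 0)

theorem abs_sourceCoeff_le (N : Network V E) (e : E) : |N.sourceCoeff e| ≤ 1 := by
  unfold sourceCoeff
  split_ifs <;> simp

/-- The net outflow of the source. -/
noncomputable def netOut [Fintype E] (N : Network V E) (f : E → ℝ) : ℝ :=
  ∑ e, f e * N.sourceCoeff e

/-- A path never returns to the source, so only the arc of its first step has a nonzero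
contribution. -/
theorem netOut_pathSign [Fintype E] {N : Network V E} {P : List (E × Bool)}
    (h : N.IsPath N.s P N.t) : N.netOut (pathSign P) = 1 := by
  obtain ⟨hw, hn⟩ := h
  cases P with
  | nil => exact absurd hw N.s_ne_t
  | cons p P =>
    obtain ⟨hp, hw⟩ := hw
    rw [List.nodup_cons] at hn
    have hs := hn.1
    have hend : ∀ q ∈ p :: P, N.stepEnd q ≠ N.s := fun q hq hqs =>
      hs (hqs ▸ List.mem_map_of_mem hq)
    have hstart : ∀ q ∈ P, N.stepStart q ≠ N.s := fun q hq hqs => by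
      have := hw.stepStart_mem hq
      rw [hqs] at this
      exact hs (by simpa using this)
    have hne : ∀ q ∈ P, N.sourceCoeff q.1 = 0 := by
      rintro ⟨e, b⟩ hq
      have h1 := hend _ (List.mem_cons_of_mem _ hq)
      have h2 := hstart _ hq
      cases b <;> simp_all [sourceCoeff, stepStart, stepEnd]
    have hloop := N.loopless p.1
    obtain ⟨e₀, b⟩ := p
    have h0 := hend _ List.mem_cons_self
    unfold netOut
    rw [Finset.sum_eq_single e₀]
    · cases b
      -- `pathSign` tests the forward step first, so it must be excluded: it would end at the
      -- source.
      · have hnot : (e₀, true) ∉ (e₀, false) :: P := fun hm => by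
          have := hend _ hm
          simp_all [stepStart, stepEnd]
        have hc : N.sourceCoeff e₀ = -1 := by
          simp_all [sourceCoeff, stepStart, stepEnd]
        simp [pathSign, hc, if_neg hnot]
      · have hc : N.sourceCoeff e₀ = 1 := by
          simp_all [sourceCoeff, stepStart, stepEnd]
        simp [pathSign, hc]
    · intro e _ hee
      by_cases hc : N.sourceCoeff e = 0
      · simp [hc]
      · have ht : ∀ b', (e, b') ∉ (e₀, b) :: P := fun b' hm => by
          rcases List.mem_cons.1 hm with hm | hm
          · exact hee (congrArg Prod.fst hm)
          · exact hc (hne _ hm)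
        simp [pathSign, if_neg (ht true), if_neg (ht false)]
    · simp

theorem netOut_change [Fintype E] {N : Network V E} {f : E → ℝ} {o : Option (List (E × Bool))}
    (h : N.IsChoice f o) : N.netOut (N.change f o) = N.amount f o := by
  cases o with
  | none => simp [netOut, change, amount]
  | some P =>
    have hP : N.netOut (pathSign P) = 1 := netOut_pathSign h.1
    have hc : N.netOut (N.change f (some P)) = N.netOut (pathSign P) * N.bottleneck f P := by
      simp only [netOut, change, Finset.sum_mul]
      exact Finset.sum_congr rfl fun e _ => by ring
    rw [hc, hP, one_mul]
    rfl

theorem netOut_add [Fintype E] (N : Network V E) (f g : E → ℝ) :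
    N.netOut (fun e => f e + g e) = N.netOut f + N.netOut g := by
  simp [netOut, add_mul, Finset.sum_add_distrib]

theorem abs_netOut_le [Fintype E] {N : Network V E} {f : E → ℝ} (hf : N.RespectsCap f) :
    |N.netOut f| ≤ ∑ e, N.cap e := by
  refine (Finset.abs_sum_le_sum_abs _ _).trans (Finset.sum_le_sum fun e _ => ?_)
  rw [abs_mul, abs_of_nonneg (hf e).1]
  exact (mul_le_of_le_one_right (hf e).1 (N.abs_sourceCoeff_le e)).trans (hf e).2

end Augmentation

/-! ### Transfinite iteration of a strategy -/

section Transfinite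

variable {V E : Type*}

/-- The flow after `α` steps of the algorithm from `f`, if the path is chosen according to `σ`. -/
noncomputable def iterFlow (N : Network V E) (σ : (E → ℝ) → Option (List (E × Bool)))
    (f : E → ℝ) (α : Ordinal.{0}) : E → ℝ := fun e =>
  f e + ∑' γ : Set.Iio α,
    N.change (N.iterFlow σ f γ.1) (σ (N.iterFlow σ f γ.1)) e
termination_by α
decreasing_by all_goals exact γ.2

/-- The change in step `γ + 1`. -/
noncomputable def iterChange (N : Network V E) (σ : (E → ℝ) → Option (List (E × Bool)))
    (f : E → ℝ) (γ : Ordinal.{0}) : E → ℝ :=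
  N.change (N.iterFlow σ f γ) (σ (N.iterFlow σ f γ))

/-- The amount pushed in step `γ + 1`. -/
noncomputable def iterAmount (N : Network V E) (σ : (E → ℝ) → Option (List (E × Bool)))
    (f : E → ℝ) (γ : Ordinal.{0}) : ℝ :=
  N.amount (N.iterFlow σ f γ) (σ (N.iterFlow σ f γ))

variable {N : Network V E} {σ : (E → ℝ) → Option (List (E × Bool))} {f : E → ℝ}

theorem iterFlow_apply (α : Ordinal.{0}) (e : E) :
    N.iterFlow σ f α e = f e + ∑' γ : Set.Iio α, N.iterChange σ f γ.1 e := by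
  rw [iterFlow]
  rfl

@[simp] theorem iterFlow_zero : N.iterFlow σ f 0 = f := by
  funext e
  rw [iterFlow_apply]
  have : IsEmpty (Set.Iio (0 : Ordinal.{0})) := ⟨fun x => not_lt_zero (Set.mem_Iio.1 x.2)⟩
  simp

theorem iterAmount_nonneg (hσ : ∀ g, N.IsChoice g (σ g)) (γ : Ordinal.{0}) :
    0 ≤ N.iterAmount σ f γ := amount_nonneg (hσ _)

theorem abs_iterChange_le (hσ : ∀ g, N.IsChoice g (σ g)) (γ : Ordinal.{0}) (e : E) :
    |N.iterChange σ f γ e| ≤ N.iterAmount σ f γ := abs_change_le (hσ _) e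

theorem summable_iterChange (hσ : ∀ g, N.IsChoice g (σ g)) {α : Ordinal.{0}}
    (h : Summable fun γ : Set.Iio α => N.iterAmount σ f γ.1) (e : E) :
    Summable fun γ : Set.Iio α => N.iterChange σ f γ.1 e :=
  Summable.of_norm_bounded h fun γ => abs_iterChange_le hσ γ.1 e

/-- Summability is essential: `tsum` takes the default value 0 otherwise. -/
theorem iterFlow_succ_of_summable (hσ : ∀ g, N.IsChoice g (σ g)) {α : Ordinal.{0}}
    (h : Summable fun γ : Set.Iio α => N.iterAmount σ f γ.1) (e : E) :
    N.iterFlow σ f (Order.succ α) e = N.iterFlow σ f α e + N.iterChange σ f α e := by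
  rw [iterFlow_apply, iterFlow_apply, add_assoc]
  congr 1
  have hs := (summable_iterChange hσ h e).hasSum
  have h1 : HasSum ((fun γ => N.iterChange σ f γ e) ∘ ((↑) : ({α} : Set Ordinal.{0}) → _))
      (N.iterChange σ f α e) := by
    simpa using hasSum_unique
      ((fun γ => N.iterChange σ f γ e) ∘ ((↑) : ({α} : Set Ordinal.{0}) → _))
  have hd : Disjoint (Set.Iio α) {α} := by simp
  have := HasSum.add_disjoint (f := fun γ => N.iterChange σ f γ e) hd hs h1
  have hU : Set.Iio α ∪ {α} = Set.Iio (Order.succ α) := by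
    ext γ
    simp [le_iff_lt_or_eq, or_comm]
  rw [hU] at this
  exact this.tsum_eq

theorem netOut_iterFlow [Fintype E] (hσ : ∀ g, N.IsChoice g (σ g)) {α : Ordinal.{0}}
    (h : Summable fun γ : Set.Iio α => N.iterAmount σ f γ.1) :
    N.netOut (N.iterFlow σ f α) = N.netOut f + ∑' γ : Set.Iio α, N.iterAmount σ f γ.1 := by
  have h1 : HasSum (fun γ : Set.Iio α => N.netOut (N.iterChange σ f γ.1))
      (N.netOut fun e => ∑' γ : Set.Iio α, N.iterChange σ f γ.1 e) :=
    hasSum_sum fun e _ => (summable_iterChange hσ h e).hasSum.mul_right _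
  have h2 : (fun γ : Set.Iio α => N.netOut (N.iterChange σ f γ.1)) =
      fun γ => N.iterAmount σ f γ.1 := funext fun γ => netOut_change (hσ _)
  rw [h2] at h1
  rw [h1.tsum_eq, ← netOut_add]
  exact congrArg _ (funext fun e => iterFlow_apply α e)

/-- Dominated convergence, with the amounts pushed as the dominating family. -/
theorem tendsto_iterFlow (hσ : ∀ g, N.IsChoice g (σ g)) {α : Ordinal.{0}}
    (h : Summable fun γ : Set.Iio α => N.iterAmount σ f γ.1) {ι : Type*} {l : Filter ι}
    {β : ι → Ordinal.{0}} (hβ : ∀ n, β n ≤ α) (hev : ∀ γ < α, ∀ᶠ n in l, γ < β n) (e : E) :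
    Tendsto (fun n => N.iterFlow σ f (β n) e) l (𝓝 (N.iterFlow σ f α e)) := by
  -- Indicators put all partial sums over one fixed index set.
  have key : ∀ n, ∑' γ : Set.Iio (β n), N.iterChange σ f γ.1 e =
      ∑' γ : Set.Iio α, (Set.Iio (β n)).indicator (fun γ => N.iterChange σ f γ e) γ.1 := by
    intro n
    rw [tsum_subtype (Set.Iio (β n)) (fun γ => N.iterChange σ f γ e),
      tsum_subtype (Set.Iio α)
        (fun γ => (Set.Iio (β n)).indicator (fun γ => N.iterChange σ f γ e) γ),
      Set.indicator_indicator, Set.inter_eq_right.2 (Set.Iio_subset_Iio (hβ n))]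
  simp only [iterFlow_apply, key]
  refine tendsto_const_nhds.add (tendsto_tsum_of_dominated_convergence h ?_ ?_)
  · intro γ
    refine tendsto_const_nhds.congr' ?_
    filter_upwards [hev γ.1 γ.2] with n hn
    rw [Set.indicator_of_mem (by exact hn)]
  · refine Eventually.of_forall fun n γ => ?_
    exact (norm_indicator_le_norm_self _ _).trans (abs_iterChange_le hσ γ.1 e)

/-- The two claims need each other: capacities bound the net outflow and hence the sums of amounts,
while summability gives the flow a meaning at later ordinals. -/
theorem summable_iterAmount_and_respectsCap [Fintype E] (hσ : ∀ g, N.IsChoice g (σ g))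
    (hf : N.RespectsCap f) (α : Ordinal.{0}) :
    (Summable fun γ : Set.Iio α => N.iterAmount σ f γ.1) ∧ N.RespectsCap (N.iterFlow σ f α) := by
  induction α using WellFoundedLT.induction with
  | ind α ih =>
  have hB : 0 ≤ ∑ e, N.cap e := Finset.sum_nonneg fun e _ => N.cap_nonneg e
  have hsum : Summable fun γ : Set.Iio α => N.iterAmount σ f γ.1 := by
    refine summable_of_sum_le (c := 2 * ∑ e, N.cap e) (fun γ => iterAmount_nonneg hσ γ.1) ?_
    intro S
    rcases S.eq_empty_or_nonempty with rfl | hS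
    · simpa using hB
    · obtain ⟨m, hmS, hm⟩ : ∃ m ∈ S, ∀ x ∈ S, x ≤ m := ⟨S.max' hS, S.max'_mem hS, S.le_max'⟩
      obtain ⟨hs, hc⟩ := ih m.1 m.2
      have hsucc := hc.add_change (hσ _)
      have hval : N.netOut (fun e => N.iterFlow σ f m e +
          N.change (N.iterFlow σ f m) (σ (N.iterFlow σ f m)) e) = N.netOut f +
          ∑' γ : Set.Iio m.1, N.iterAmount σ f γ.1 + N.iterAmount σ f m := by
        rw [netOut_add, netOut_iterFlow hσ hs, netOut_change (hσ _)]
        rfl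
      have h1 := abs_le.1 (abs_netOut_le hsucc)
      have h2 := abs_le.1 (abs_netOut_le hf)
      have h3 : ∑ γ ∈ S.erase m, N.iterAmount σ f γ.1 ≤
          ∑' γ : Set.Iio m.1, N.iterAmount σ f γ.1 := by
        have hsub : ∀ γ ∈ S.erase m, γ.1 < m.1 := fun γ hγ =>
          lt_of_le_of_ne (hm γ (Finset.mem_of_mem_erase hγ))
            fun h => Finset.ne_of_mem_erase hγ (Subtype.ext h)
        let ι : {x // x ∈ S.erase m} ↪ Set.Iio m.1 := ⟨fun γ => ⟨γ.1.1, hsub γ.1 γ.2⟩,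
          fun a b hab => Subtype.ext (Subtype.ext (congrArg (fun x : Set.Iio m.1 => x.1) hab))⟩
        have := hs.sum_le_tsum ((S.erase m).attach.map ι) (fun γ _ => iterAmount_nonneg hσ γ.1)
        rw [Finset.sum_map] at this
        rw [← Finset.sum_attach]
        exact this
      rw [← Finset.sum_erase_add _ _ hmS]
      linarith
  refine ⟨hsum, ?_⟩
  rcases Ordinal.zero_or_succ_or_isSuccLimit α with rfl | ⟨β, rfl⟩ | hlim
  · simpa using hf
  · have hβ := ih β (Order.lt_succ β)
    rw [show N.iterFlow σ f (Order.succ β) = _ from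
      funext (iterFlow_succ_of_summable hσ hβ.1)]
    exact hβ.2.add_change (hσ _)
  -- At a limit, the constraints persist because they are closed conditions.
  · intro e
    have ht := tendsto_iterFlow hσ hsum (l := atTop) (β := fun b : Set.Iio α => b.1)
      (fun b => (show b.1 < α from b.2).le) (fun γ hγ => by
        filter_upwards [eventually_ge_atTop
          (⟨Order.succ γ, hlim.succ_lt hγ⟩ : Set.Iio α)] with b hb
        exact Order.succ_le_iff.1 hb) e
    have : Nonempty (Set.Iio α) := ⟨⟨0, hlim.bot_lt⟩⟩
    exact ⟨ge_of_tendsto' ht fun b => ((ih b.1 b.2).2 e).1,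
      le_of_tendsto' ht fun b => ((ih b.1 b.2).2 e).2⟩

theorem summable_iterAmount [Fintype E] (hσ : ∀ g, N.IsChoice g (σ g)) (hf : N.RespectsCap f)
    (α : Ordinal.{0}) : Summable fun γ : Set.Iio α => N.iterAmount σ f γ.1 :=
  (summable_iterAmount_and_respectsCap hσ hf α).1

theorem respectsCap_iterFlow [Fintype E] (hσ : ∀ g, N.IsChoice g (σ g)) (hf : N.RespectsCap f)
    (α : Ordinal.{0}) : N.RespectsCap (N.iterFlow σ f α) :=
  (summable_iterAmount_and_respectsCap hσ hf α).2

theorem iterFlow_succ [Fintype E] (hσ : ∀ g, N.IsChoice g (σ g)) (hf : N.RespectsCap f)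
    (α : Ordinal.{0}) (e : E) :
    N.iterFlow σ f (Order.succ α) e = N.iterFlow σ f α e + N.iterChange σ f α e :=
  iterFlow_succ_of_summable hσ (summable_iterAmount hσ hf α) e

/-- The strategy has no memory, so restarting from the flow at α reproduces the rest of the run. -/
theorem iterFlow_add [Fintype E] (hσ : ∀ g, N.IsChoice g (σ g)) (hf : N.RespectsCap f)
    (α β : Ordinal.{0}) :
    N.iterFlow σ f (α + β) = N.iterFlow σ (N.iterFlow σ f α) β := by
  induction β using WellFoundedLT.induction with
  | ind β ih =>
  funext e
  rw [iterFlow_apply (f := N.iterFlow σ f α), iterFlow_apply, iterFlow_apply (f := f) (α := α),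
    add_assoc]
  congr 1
  have h1 := (summable_iterChange hσ (summable_iterAmount hσ hf α) e).hasSum
  have h2 := (summable_iterChange hσ
    (summable_iterAmount hσ (respectsCap_iterFlow hσ hf α) β) e).hasSum
  let φ : Set.Iio β ≃ Set.Ico α (α + β) :=
    { toFun := fun δ => ⟨α + δ.1, le_self_add, (add_lt_add_iff_left α).2 δ.2⟩
      invFun := fun γ => ⟨γ.1 - α, by
        have hγ : γ.1 = α + (γ.1 - α) := (Ordinal.add_sub_cancel_of_le γ.2.1).symm
        have := γ.2.2
        rw [hγ] at this
        simpa using this⟩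
      left_inv := fun δ => Subtype.ext (by simp)
      right_inv := fun γ => Subtype.ext (Ordinal.add_sub_cancel_of_le γ.2.1) }
  have h3 : HasSum ((fun γ => N.iterChange σ f γ e) ∘ ((↑) : Set.Ico α (α + β) → _))
      (∑' γ : Set.Iio β, N.iterChange σ (N.iterFlow σ f α) γ.1 e) := by
    rw [← φ.hasSum_iff]
    convert h2 using 2 with δ
    have : N.iterFlow σ f (α + δ.1) = N.iterFlow σ (N.iterFlow σ f α) δ.1 := ih δ.1 δ.2
    simp only [Function.comp, iterChange, φ, Equiv.coe_fn_mk, this]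
  have hd : Disjoint (Set.Iio α) (Set.Ico α (α + β)) :=
    Set.disjoint_left.2 fun γ h h' => not_le_of_gt h h'.1
  have := HasSum.add_disjoint (f := fun γ => N.iterChange σ f γ e) hd h1 h3
  rw [Set.Iio_union_Ico_eq_Iio le_self_add] at this
  exact this.tsum_eq

theorem iterFlow_of_eq_none (h : σ f = none) (α : Ordinal.{0}) : N.iterFlow σ f α = f := by
  induction α using WellFoundedLT.induction with
  | ind α ih =>
  funext e
  have : ∀ γ : Set.Iio α, N.iterChange σ f γ.1 e = 0 := fun γ => by
    rw [iterChange, ih γ.1 γ.2, h]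
    rfl
  simp [iterFlow_apply, this]

theorem netOut_iterFlow_le [Fintype E] (hσ : ∀ g, N.IsChoice g (σ g)) (hf : N.RespectsCap f)
    (α : Ordinal.{0}) : N.netOut f ≤ N.netOut (N.iterFlow σ f α) := by
  rw [netOut_iterFlow hσ (summable_iterAmount hσ hf α)]
  exact le_add_of_nonneg_right (tsum_nonneg fun γ => iterAmount_nonneg hσ γ.1)

theorem iterFlow_succ_eq_iff [Fintype E] (hσ : ∀ g, N.IsChoice g (σ g)) (hf : N.RespectsCap f)
    (α : Ordinal.{0}) : N.iterFlow σ f α = N.iterFlow σ f (Order.succ α) ↔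
      σ (N.iterFlow σ f α) = none := by
  have hs : N.iterFlow σ f (Order.succ α) =
      fun e => N.iterFlow σ f α e + N.iterChange σ f α e := funext (iterFlow_succ hσ hf α)
  constructor
  · intro h
    have h1 := congrArg N.netOut h
    rw [hs, netOut_add, iterChange, netOut_change (hσ _)] at h1
    have h2 : N.amount (N.iterFlow σ f α) (σ (N.iterFlow σ f α)) = 0 := by linarith
    have h3 := hσ (N.iterFlow σ f α)
    cases ho : σ (N.iterFlow σ f α) with
    | none => rfl
    | some P =>
      rw [ho] at h2 h3
      exact absurd h2 (IsAugmenting.bottleneck_pos h3).ne'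
  · intro h
    rw [hs]
    funext e
    simp [iterChange, h, change]

/-- Otherwise the net outflow would embed the ordinals strictly monotonically into ℝ. -/
theorem exists_iterFlow_eq_none [Fintype E] (hσ : ∀ g, N.IsChoice g (σ g))
    (hf : N.RespectsCap f) : ∃ α : Ordinal.{0}, σ (N.iterFlow σ f α) = none := by
  by_contra! hne
  refine not_injective_of_ordinal (fun α : Ordinal.{0} => N.netOut (N.iterFlow σ f α))
    (StrictMono.injective fun α β hαβ => ?_)
  have hα := respectsCap_iterFlow hσ hf α
  have hs : N.iterFlow σ f (Order.succ α) =
      fun e => N.iterFlow σ f α e + N.iterChange σ f α e := funext (iterFlow_succ hσ hf α)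
  have h1 : N.netOut (N.iterFlow σ f α) < N.netOut (N.iterFlow σ f (Order.succ α)) := by
    rw [hs, netOut_add, iterChange, netOut_change (hσ _)]
    have h3 := hσ (N.iterFlow σ f α)
    cases ho : σ (N.iterFlow σ f α) with
    | none => exact absurd ho (hne α)
    | some P =>
      rw [ho] at h3
      exact lt_add_of_pos_right _ (IsAugmenting.bottleneck_pos h3)
  refine h1.trans_le ?_
  have hle : Order.succ α ≤ β := Order.succ_le_of_lt hαβ
  have := netOut_iterFlow_le hσ (respectsCap_iterFlow hσ hf (Order.succ α)) (β - Order.succ α)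
  rwa [← iterFlow_add hσ hf, Ordinal.add_sub_cancel_of_le hle] at this

theorem IsFlow.respectsCap [Fintype E] (h : N.IsFlow f) : N.RespectsCap f :=
  fun e => ⟨h.nonneg e, h.le_cap e⟩

/-- The run of the algorithm from `f` that follows the strategy `σ`. -/
noncomputable def runOfStrategy [Fintype E] (hσ : ∀ g, N.IsChoice g (σ g)) (hf : N.IsFlow f) :
    N.Run where
  flow := N.iterFlow σ f
  path β := σ (N.iterFlow σ f β)
  isFlow_zero := by rwa [iterFlow_zero]
  isChoice β := hσ _
  flow_succ := iterFlow_succ hσ hf.respectsCap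
  flow_limit α _ e := by
    rw [iterFlow_zero, iterFlow_apply, add_sub_cancel_left]
    exact (summable_iterChange hσ (summable_iterAmount hσ hf.respectsCap α) e).hasSum

/-- Once no path is available the flow stays fixed, so a path available at α shows that the run has
not stopped at any earlier ordinal or at α. -/
theorem exists_isRunTime_gt [Fintype E] (hσ : ∀ g, N.IsChoice g (σ g)) (hf : N.IsFlow f)
    {α : Ordinal.{0}} (hα : σ (N.iterFlow σ f α) ≠ none) :
    ∃ τ : Ordinal.{0}, (runOfStrategy hσ hf).IsRunTime τ ∧ α < τ := by
  have hset : {β | (runOfStrategy hσ hf).flow β = (runOfStrategy hσ hf).flow (Order.succ β)} =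
      {β | σ (N.iterFlow σ f β) = none} :=
    Set.ext fun β => iterFlow_succ_eq_iff hσ hf.respectsCap β
  have hne : {β | σ (N.iterFlow σ f β) = none}.Nonempty :=
    exists_iterFlow_eq_none hσ hf.respectsCap
  refine ⟨sInf {β | σ (N.iterFlow σ f β) = none}, ?_, ?_⟩
  · rw [Run.IsRunTime, hset]
    exact isLeast_csInf hne
  · have hmem : σ (N.iterFlow σ f (sInf {β | σ (N.iterFlow σ f β) = none})) = none :=
      csInf_mem hne
    by_contra! hle
    apply hα
    have := iterFlow_of_eq_none (N := N) hmem
      (α - sInf {β | σ (N.iterFlow σ f β) = none})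
    rw [← iterFlow_add hσ hf.respectsCap, Ordinal.add_sub_cancel_of_le hle] at this
    rw [this]
    exact hmem

end Transfinite
end Network

/-! ### Abstract towers and the strategy on them -/

namespace Network

open Filter Topology

/-- `k` levels of three arcs each, in a network with constant capacity `C`. For each arc `arc i z`
there is a path `op i z` that uses this arc forwards and the other two arcs of the level backwards.
It uses `arc (i - 1) z` forwards as well, and no further arcs backwards or arcs of the levels. -/
structure Tower {V E : Type*} (N : Network V E) (k : ℕ) (C : ℝ) where
  cap_eq : ∀ e, N.cap e = C
  arc : Fin k → Fin 3 → E
  op : Fin k → Fin 3 → List (E × Bool)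
  isPath : ∀ i z, N.IsPath N.s (op i z) N.t
  mem_backward : ∀ i z e, (e, false) ∈ op i z ↔ ∃ j, j ≠ z ∧ e = arc i j
  pathSign_same : ∀ i z j, pathSign (op i z) (arc i j) = if j = z then 1 else -1
  pathSign_below : ∀ i z i' j, i'.val + 1 = i.val →
    pathSign (op i z) (arc i' j) = if j = z then 1 else 0
  pathSign_other : ∀ i z i' j, i' ≠ i → i'.val + 1 ≠ i.val → pathSign (op i z) (arc i' j) = 0

/-- The number of steps after which the lowest `n` levels are exhausted. -/
noncomputable def towerLength : ℕ → Ordinal.{0}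
  | 0 => 0
  | n + 1 => (2 + towerLength n) * ω

/-- The summand 2 starts the induction: `towerLength 0` is 0, so the bound without it fails there.
-/
theorem opow_le_two_add_towerLength (n : ℕ) : ω ^ (n : Ordinal.{0}) ≤ 2 + towerLength n ∧
    (n ≠ 0 → ω ^ (n : Ordinal.{0}) ≤ towerLength n) := by
  induction n with
  | zero => simp [towerLength]
  | succ n ih =>
    have h : ω ^ ((n + 1 : ℕ) : Ordinal.{0}) ≤ towerLength (n + 1) := by
      rw [towerLength, Nat.cast_succ, Ordinal.opow_add, Ordinal.opow_one]
      exact mul_le_mul_left ih.1 ω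
    exact ⟨h.trans le_add_self, fun _ => h⟩

theorem opow_le_of_towerLength_lt {n : ℕ} {τ : Ordinal.{0}} (h : towerLength n < τ) :
    ω ^ (n : Ordinal.{0}) ≤ τ := by
  rcases eq_or_ne n 0 with rfl | hn
  · simpa [towerLength] using Order.succ_le_of_lt h
  · exact ((opow_le_two_add_towerLength n).2 hn).trans h.le

theorem fin_three_cases {z l s : Fin 3} (hzl : z ≠ l) (hzs : z ≠ s) (hls : l ≠ s) (m : Fin 3) :
    m = z ∨ m = l ∨ m = s := by
  revert z l s m
  decide

theorem fin_three_add_ne (z : Fin 3) : z + 1 ≠ z ∧ z + 2 ≠ z ∧ z + 1 ≠ z + 2 := by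
  revert z
  decide

namespace Tower

variable {V E : Type*} {N : Network V E} {k : ℕ} {C : ℝ}

/-- Level `i` is active: exactly one of its arcs, `arc i z`, has no flow, and no level below has two
arcs with flow. -/
def Active (T : N.Tower k C) (f : E → ℝ) (i : Fin k) (z : Fin 3) : Prop :=
  f (T.arc i z) = 0 ∧ (∀ j, j ≠ z → 0 < f (T.arc i j)) ∧
    ∀ i' < i, ∀ j j', j ≠ j' → ¬ (0 < f (T.arc i' j) ∧ 0 < f (T.arc i' j'))

theorem Active.level_le {T : N.Tower k C} {f : E → ℝ} {i i' : Fin k} {z z' : Fin 3}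
    (h : T.Active f i z) (h' : T.Active f i' z') : i' ≤ i := by
  by_contra! hlt
  obtain ⟨h1, h2, h3⟩ := fin_three_add_ne z
  exact h'.2.2 i hlt _ _ h3 ⟨h.2.1 _ h1, h.2.1 _ h2⟩

/-- Uniqueness determines the arbitrary choice made in `strategy`. -/
theorem Active.unique {T : N.Tower k C} {f : E → ℝ} {i i' : Fin k} {z z' : Fin 3}
    (h : T.Active f i z) (h' : T.Active f i' z') : i' = i ∧ z' = z := by
  obtain rfl : i' = i := le_antisymm (h.level_le h') (h'.level_le h)
  refine ⟨rfl, ?_⟩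
  by_contra hz
  exact (h.2.1 _ hz).ne' h'.1

open Classical in
/-- The strategy that operates on the lowest active level. -/
noncomputable def strategy (T : N.Tower k C) (f : E → ℝ) : Option (List (E × Bool)) :=
  if h : ∃ p : Fin k × Fin 3, T.Active f p.1 p.2 ∧ N.IsAugmenting f (T.op p.1 p.2) then
    some (T.op h.choose.1 h.choose.2)
  else if h : ∃ P, N.IsAugmenting f P then some h.choose
  else none

theorem isChoice_strategy (T : N.Tower k C) (f : E → ℝ) : N.IsChoice f (T.strategy f) := by
  unfold strategy
  split_ifs with h1 h2
  · exact h1.choose_spec.2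
  · exact h2.choose_spec
  · exact fun P hP => h2 ⟨P, hP⟩

theorem strategy_eq (T : N.Tower k C) {f : E → ℝ} {i : Fin k} {z : Fin 3} (h : T.Active f i z)
    (haug : N.IsAugmenting f (T.op i z)) : T.strategy f = some (T.op i z) := by
  have hex : ∃ p : Fin k × Fin 3, T.Active f p.1 p.2 ∧ N.IsAugmenting f (T.op p.1 p.2) :=
    ⟨(i, z), h, haug⟩
  obtain ⟨h1, h2⟩ := h.unique hex.choose_spec.1
  rw [strategy, dif_pos hex, h1, h2]

theorem strategy_ne_none (T : N.Tower k C) {f : E → ℝ} {P : List (E × Bool)}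
    (haug : N.IsAugmenting f P) : T.strategy f ≠ none := by
  intro h
  have := T.isChoice_strategy f
  rw [h] at this
  exact this P haug

/-- The arc with the smaller flow x is the bottleneck, since every forward arc has spare capacity at
least x. -/
theorem isAugmenting_op (T : N.Tower k C) {f : E → ℝ} {i : Fin k} {z l s : Fin 3} {x : ℝ}
    (hzl : z ≠ l) (hzs : z ≠ s) (hls : l ≠ s) (hl : x ≤ f (T.arc i l)) (hs : f (T.arc i s) = x)
    (hx : 0 < x) (hC : ∀ e, f e + x ≤ C) :
    N.IsAugmenting f (T.op i z) ∧ N.bottleneck f (T.op i z) = x := by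
  have hres : ∀ p ∈ T.op i z, x ≤ N.residual f p := by
    rintro ⟨e, b⟩ hp
    cases b
    · obtain ⟨j, hj, rfl⟩ := (T.mem_backward i z e).1 hp
      simp only [residual, Bool.false_eq_true, if_false]
      rcases fin_three_cases hzl hzs hls j with rfl | rfl | rfl
      · exact absurd rfl hj
      · exact hl
      · exact hs.ge
    · simp only [residual, if_true, T.cap_eq]
      linarith [hC e]
  have hmem : (T.arc i s, false) ∈ T.op i z := (T.mem_backward i z _).2 ⟨s, hzs.symm, rfl⟩
  refine ⟨⟨T.isPath i z, fun p hp => hx.trans_le (hres p hp)⟩, le_antisymm ?_ ?_⟩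
  · refine (N.bottleneck_le f hmem).trans ?_
    simp [residual, hs]
  · refine le_csInf ⟨_, _, hmem, rfl⟩ ?_
    rintro _ ⟨p, hp, rfl⟩
    exact hres p hp

theorem iterFlow_one [Fintype E] (T : N.Tower k C) {f : E → ℝ} (hf : N.RespectsCap f)
    {i : Fin k} {z l s : Fin 3} {x : ℝ}
    (hzl : z ≠ l) (hzs : z ≠ s) (hls : l ≠ s) (hz : f (T.arc i z) = 0) (hl : x ≤ f (T.arc i l))
    (hs : f (T.arc i s) = x) (hx : 0 < x) (hC : ∀ e, f e + x ≤ C)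
    (hlow : ∀ i' < i, ∀ j j', j ≠ j' → ¬ (0 < f (T.arc i' j) ∧ 0 < f (T.arc i' j'))) (e : E) :
    N.iterFlow T.strategy f 1 e = f e + pathSign (T.op i z) e * x := by
  obtain ⟨haug, hb⟩ := T.isAugmenting_op hzl hzs hls hl hs hx hC
  have hact : T.Active f i z := by
    refine ⟨hz, fun j hj => ?_, hlow⟩
    rcases fin_three_cases hzl hzs hls j with rfl | rfl | rfl
    · exact absurd rfl hj
    · exact hx.trans_le hl
    · exact hs ▸ hx
  have := iterFlow_succ T.isChoice_strategy hf 0 e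
  rw [Order.succ_eq_add_one, zero_add, iterChange, iterFlow_zero, T.strategy_eq hact haug] at this
  rw [this, change, hb]

/-! ### Exhausting the levels by induction -/

/-- The flows on the arcs of level `i` are, in some order, `0`, `r * Y` and `r ^ 2 * Y`. -/
def Loaded (T : N.Tower k C) (r : ℝ) (f : E → ℝ) (i : Fin k) (z l s : Fin 3) (Y : ℝ) : Prop :=
  z ≠ l ∧ z ≠ s ∧ l ≠ s ∧ f (T.arc i z) = 0 ∧ f (T.arc i l) = r * Y ∧ f (T.arc i s) = r ^ 2 * Y

/-- The effect of the algorithm on a tower whose level `n - 1` is loaded and whose lower levels are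
empty: these levels are exhausted, and little flow is added elsewhere. -/
def Exhausts [Fintype E] (T : N.Tower k C) (r : ℝ) (n : ℕ) : Prop :=
  ∀ (f : E → ℝ) (Y : ℝ), N.RespectsCap f → 0 < Y →
    (∀ j : Fin k, j.val + 1 = n → ∃ z l s, T.Loaded r f j z l s Y) →
    (∀ j : Fin k, j.val + 1 < n → ∀ m, f (T.arc j m) = 0) →
    (∀ e, f e + n * Y ≤ C) →
    (∀ j : Fin k, j.val < n → ∀ m, N.iterFlow T.strategy f (towerLength n) (T.arc j m) = 0) ∧
    (∀ j : Fin k, n ≤ j.val → ∀ m,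
      N.iterFlow T.strategy f (towerLength n) (T.arc j m) = f (T.arc j m)) ∧
    ∀ e, N.iterFlow T.strategy f (towerLength n) e ≤ f e + n * Y

/-- The two pushes add at most r²Y + r³Y = rY to any arc; the lower levels, then loaded with rY, add
at most i·rY. -/
theorem exhausts_round [Fintype E] (T : N.Tower k C) {r : ℝ} (hr0 : 0 < r)
    (hr : r ^ 2 = 1 - r) {i : Fin k} (ih : T.Exhausts r i.val) {f : E → ℝ} {Y : ℝ}
    (hf : N.RespectsCap f) (hY : 0 < Y) {z l s : Fin 3} (hload : T.Loaded r f i z l s Y)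
    (hlow : ∀ j < i, ∀ m, f (T.arc j m) = 0) (hC : ∀ e, f e + (i.val + 1 : ℕ) * Y ≤ C) :
    T.Loaded r (N.iterFlow T.strategy f (2 + towerLength i.val)) i l s z (r ^ 2 * Y) ∧
    (∀ j < i, ∀ m, N.iterFlow T.strategy f (2 + towerLength i.val) (T.arc j m) = 0) ∧
    (∀ j, i < j → ∀ m, N.iterFlow T.strategy f (2 + towerLength i.val) (T.arc j m) =
      f (T.arc j m)) ∧
    ∀ e, N.iterFlow T.strategy f (2 + towerLength i.val) e ≤
      f e + (i.val + 1 : ℕ) * (r * Y) := by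
  obtain ⟨hzl, hzs, hls, hz, hl, hs⟩ := hload
  have hr1 : r < 1 := by nlinarith
  have hi0 : (0 : ℝ) ≤ i.val := Nat.cast_nonneg _
  have hr3 : r ^ 3 = r - r ^ 2 := by
    calc r ^ 3 = r * r ^ 2 := by ring
      _ = r - r ^ 2 := by rw [hr]; ring_nf; rw [hr]; ring
  have h3Y : r ^ 3 * Y = r * Y - r ^ 2 * Y := by rw [hr3]; ring
  have h2p : 0 < r ^ 2 * Y := by positivity
  have h3p : 0 < r ^ 3 * Y := by positivity
  have hsum : r ^ 2 * Y + r ^ 3 * Y = r * Y := by rw [h3Y]; ring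
  have hrY : r * Y < Y := by nlinarith
  have hiY : 0 ≤ (i.val : ℝ) * Y := by positivity
  have hirY : (i.val : ℝ) * (r * Y) ≤ i.val * Y := by gcongr
  push_cast at hC ⊢
  have hC' : ∀ e, f e + Y + i.val * Y ≤ C := fun e => by linarith [hC e]
  have hpos : ∀ P : List (E × Bool), ∀ e, pathSign P e ≤ 1 := fun P e =>
    (abs_le.1 (abs_pathSign_le P e)).2
  -- the first operation
  have hf1 := T.iterFlow_one hf hzl hzs hls hz (x := r ^ 2 * Y) (by linarith) hs h2p
    (fun e => by linarith [hC' e])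
    (fun j hj m m' _ h => h.1.ne' (hlow j hj m))
  have hrc1 := respectsCap_iterFlow T.isChoice_strategy hf 1
  set f1 := N.iterFlow T.strategy f 1 with hf1def
  have h1le : ∀ e, f1 e ≤ f e + r ^ 2 * Y := fun e => by
    rw [hf1 e]
    linarith [mul_le_of_le_one_left h2p.le (hpos (T.op i z) e)]
  have h1z : f1 (T.arc i z) = r ^ 2 * Y := by simp [hf1, T.pathSign_same, hz]
  have h1l : f1 (T.arc i l) = r ^ 3 * Y := by
    simp [hf1, T.pathSign_same, hl, hzl.symm, h3Y, sub_eq_add_neg]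
  have h1s : f1 (T.arc i s) = 0 := by simp [hf1, T.pathSign_same, hs, hzs.symm]
  have h1b : ∀ j : Fin k, j.val + 1 = i.val → ∀ m,
      f1 (T.arc j m) = if m = z then r ^ 2 * Y else 0 := fun j hj m => by
    rw [hf1, T.pathSign_below i z j m hj, hlow j (Fin.lt_def.2 (by omega)) m]
    split_ifs <;> simp
  have h1o : ∀ j : Fin k, j ≠ i → j.val + 1 ≠ i.val → ∀ m, f1 (T.arc j m) = f (T.arc j m) :=
    fun j hj hj' m => by rw [hf1, T.pathSign_other i z j m hj hj']; simp
  -- the second operation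
  have hf2 := T.iterFlow_one hrc1 hzs.symm hls.symm hzl h1s (x := r ^ 3 * Y)
    (by rw [h1z]; nlinarith) h1l h3p
    (fun e => by linarith [hC' e, h1le e])
    -- After one push the level below carries flow on a single arc only, so it does not yet take
    -- precedence over level i.
    (fun j hj m m' hmm h => by
      rcases eq_or_ne (j.val + 1) i.val with hji | hji
      · rw [h1b j hji, h1b j hji] at h
        by_cases hm : m = z
        · have hm' : m' ≠ z := fun h' => hmm (hm.trans h'.symm)
          simp [hm'] at h
        · simp [hm] at h
      · rw [h1o j hj.ne hji, hlow j hj] at h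
        exact lt_irrefl _ h.1)
  have hrc2 := respectsCap_iterFlow T.isChoice_strategy hrc1 1
  have hadd : N.iterFlow T.strategy f (2 + towerLength i.val) =
      N.iterFlow T.strategy (N.iterFlow T.strategy f1 1) (towerLength i.val) := by
    rw [← one_add_one_eq_two, add_assoc, iterFlow_add T.isChoice_strategy hf,
      iterFlow_add T.isChoice_strategy hrc1]
  rw [hadd]
  set f2 := N.iterFlow T.strategy f1 1 with hf2def
  have h2le : ∀ e, f2 e ≤ f e + r * Y := fun e => by
    rw [hf2 e]
    linarith [mul_le_of_le_one_left h3p.le (hpos (T.op i s) e), h1le e]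
  have h2s : f2 (T.arc i s) = r ^ 3 * Y := by simp [hf2, T.pathSign_same, h1s]
  have h2l : f2 (T.arc i l) = 0 := by simp [hf2, T.pathSign_same, h1l, hls]
  have h2z : f2 (T.arc i z) = r ^ 4 * Y := by
    simp only [hf2, T.pathSign_same, h1z, hzs, if_false]
    linear_combination (-r * Y) * hr3
  have h2b : ∀ j : Fin k, j.val + 1 = i.val → ∀ m,
      f2 (T.arc j m) = (if m = z then r ^ 2 * Y else 0) + if m = s then r ^ 3 * Y else 0 :=
    fun j hj m => by
      rw [hf2, T.pathSign_below i s j m hj, h1b j hj]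
      congr 1
      split_ifs <;> simp
  have h2o : ∀ j : Fin k, j ≠ i → j.val + 1 ≠ i.val → ∀ m, f2 (T.arc j m) = f (T.arc j m) :=
    fun j hj hj' m => by rw [hf2, T.pathSign_other i s j m hj hj', h1o j hj hj']; simp
  -- the levels below
  obtain ⟨g1, g2, g3⟩ := ih f2 (r * Y) hrc2 (by positivity)
    (fun j hj => ⟨l, z, s, hzl.symm, hls, hzs, by
        rw [h2b j hj]; simp [hzl.symm, hls], by
        rw [h2b j hj]; simp [hzs]; ring, by
        rw [h2b j hj]; simp [hzs.symm]; ring⟩)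
    (fun j hj m => by
      rw [h2o j (Fin.ne_of_lt (Fin.lt_def.2 (by omega))) (by omega),
        hlow j (Fin.lt_def.2 (by omega))])
    (fun e => by linarith [h2le e, hC' e])
  refine ⟨⟨hls, hzl.symm, hzs.symm, ?_, ?_, ?_⟩, fun j hj m => g1 j hj m, fun j hj m => ?_,
    fun e => ?_⟩
  · rw [g2 i le_rfl, h2l]
  · rw [g2 i le_rfl, h2s]; ring
  · rw [g2 i le_rfl, h2z]; ring
  · rw [g2 j (Fin.le_def.1 hj.le), h2o j hj.ne' (by have := Fin.lt_def.1 hj; omega)]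
  · linarith [g3 e, h2le e]

/-- The last clause keeps a reserve of (i + 1)r²ⁿY for future growth. It supplies the capacity
hypothesis of the next round without summing a geometric series. -/
theorem exhausts_rounds [Fintype E] (T : N.Tower k C) {r : ℝ} (hr0 : 0 < r)
    (hr : r ^ 2 = 1 - r) {i : Fin k} (ih : T.Exhausts r i.val) {f : E → ℝ} {Y : ℝ}
    (hf : N.RespectsCap f) (hY : 0 < Y) {z l s : Fin 3} (hload : T.Loaded r f i z l s Y)
    (hlow : ∀ j < i, ∀ m, f (T.arc j m) = 0) (hC : ∀ e, f e + (i.val + 1 : ℕ) * Y ≤ C) (n : ℕ) :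
    (∃ z l s, T.Loaded r (N.iterFlow T.strategy f ((2 + towerLength i.val) * n)) i z l s
      ((r ^ 2) ^ n * Y)) ∧
    (∀ j < i, ∀ m, N.iterFlow T.strategy f ((2 + towerLength i.val) * n) (T.arc j m) = 0) ∧
    (∀ j, i < j → ∀ m, N.iterFlow T.strategy f ((2 + towerLength i.val) * n) (T.arc j m) =
      f (T.arc j m)) ∧
    ∀ e, N.iterFlow T.strategy f ((2 + towerLength i.val) * n) e +
      (i.val + 1 : ℕ) * ((r ^ 2) ^ n * Y) ≤ f e + (i.val + 1 : ℕ) * Y := by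
  induction n with
  | zero =>
    simp only [Nat.cast_zero, mul_zero, iterFlow_zero, pow_zero, one_mul]
    exact ⟨⟨z, l, s, hload⟩, hlow, fun _ _ _ => trivial, fun e => le_rfl⟩
  | succ n ihn =>
    obtain ⟨⟨z', l', s', h1⟩, h2, h3, h4⟩ := ihn
    have hrc := respectsCap_iterFlow T.isChoice_strategy hf ((2 + towerLength i.val) * n)
    have hstep : N.iterFlow T.strategy f ((2 + towerLength i.val) * (n + 1 : ℕ)) =
        N.iterFlow T.strategy (N.iterFlow T.strategy f ((2 + towerLength i.val) * n))
          (2 + towerLength i.val) := by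
      rw [← iterFlow_add T.isChoice_strategy hf, Nat.cast_succ, mul_add_one]
    rw [hstep]
    obtain ⟨g1, g2, g3, g4⟩ := T.exhausts_round hr0 hr ih hrc
      (by positivity : 0 < (r ^ 2) ^ n * Y) h1 h2 (fun e => (h4 e).trans (hC e))
    refine ⟨⟨l', s', z', by convert g1 using 1; ring⟩, g2,
      fun j hj m => (g3 j hj m).trans (h3 j hj m), fun e => ?_⟩
    have e1 := g4 e
    have e2 := h4 e
    -- A round spends the fraction r of the reserve and keeps the fraction r² = 1 - r.
    have e3 : ((i.val + 1 : ℕ) : ℝ) * ((r ^ 2) ^ (n + 1) * Y) +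
        ((i.val + 1 : ℕ) : ℝ) * (r * ((r ^ 2) ^ n * Y)) =
        ((i.val + 1 : ℕ) : ℝ) * ((r ^ 2) ^ n * Y) := by
      rw [pow_succ]
      linear_combination (((i.val + 1 : ℕ) : ℝ) * (r ^ 2) ^ n * Y) * hr
    linarith

theorem exhausts_succ [Fintype E] (T : N.Tower k C) {r : ℝ} (hr0 : 0 < r)
    (hr : r ^ 2 = 1 - r) {i : Fin k} (ih : T.Exhausts r i.val) : T.Exhausts r (i.val + 1) := by
  intro f Y hf hY hload hlow hC
  obtain ⟨z, l, s, hload⟩ := hload i rfl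
  have hlow' : ∀ j < i, ∀ m, f (T.arc j m) = 0 := fun j hj m =>
    hlow j (by have := Fin.lt_def.1 hj; omega) m
  have hrounds := T.exhausts_rounds hr0 hr ih hf hY hload hlow' hC
  have hr1 : r < 1 := by nlinarith
  have hlim : Tendsto (fun n : ℕ => (r ^ 2) ^ n * Y) atTop (𝓝 0) := by
    simpa using (tendsto_pow_atTop_nhds_zero_of_lt_one (by positivity)
      (by nlinarith : r ^ 2 < 1)).mul_const Y
  have ht : ∀ e, Tendsto (fun n : ℕ => N.iterFlow T.strategy f ((2 + towerLength i.val) * n) e)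
      atTop (𝓝 (N.iterFlow T.strategy f (towerLength (i.val + 1)) e)) := by
    intro e
    refine tendsto_iterFlow T.isChoice_strategy
      (summable_iterAmount T.isChoice_strategy hf _) (fun n => ?_) (fun γ hγ => ?_) e
    · rw [towerLength]
      exact mul_le_mul_right (Ordinal.natCast_lt_omega0 n).le _
    -- Finitely many rounds pass every ordinal below the product with ω.
    · rw [towerLength, Ordinal.lt_mul_iff_of_isSuccLimit Ordinal.isSuccLimit_omega0] at hγ
      obtain ⟨d, hd, hγ⟩ := hγ
      obtain ⟨m, rfl⟩ := Ordinal.lt_omega0.1 hd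
      filter_upwards [eventually_ge_atTop m] with n hn
      exact hγ.trans_le (mul_le_mul_right (by exact_mod_cast hn) _)
  -- Level i is emptied only in the limit, as all its flows are at most r²ⁿY.
  have hle : ∀ n : ℕ, ∀ m, N.iterFlow T.strategy f ((2 + towerLength i.val) * n) (T.arc i m) ≤
      (r ^ 2) ^ n * Y := by
    intro n m
    obtain ⟨⟨z', l', s', hzl, hzs, hls, hz, hl, hs⟩, -⟩ := hrounds n
    have hp : 0 < (r ^ 2) ^ n * Y := by positivity
    rcases fin_three_cases hzl hzs hls m with rfl | rfl | rfl
    · rw [hz]; exact hp.le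
    · rw [hl]; nlinarith
    · rw [hs]; nlinarith
  have hnn : ∀ n e, 0 ≤ N.iterFlow T.strategy f ((2 + towerLength i.val) * (n : ℕ)) e :=
    fun n e => (respectsCap_iterFlow T.isChoice_strategy hf _ e).1
  refine ⟨fun j hj m => ?_, fun j hj m => ?_, fun e => ?_⟩
  · rcases eq_or_ne j i with rfl | hji
    · exact tendsto_nhds_unique (ht _)
        (squeeze_zero (fun n => hnn n _) (fun n => hle n m) hlim)
    · refine tendsto_nhds_unique (ht _) (tendsto_const_nhds.congr fun n => ?_)
      exact ((hrounds n).2.1 j (lt_of_le_of_ne (Fin.le_def.2 (by omega)) hji) m).symm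
  · refine tendsto_nhds_unique (ht _) (tendsto_const_nhds.congr fun n => ?_)
    exact ((hrounds n).2.2.1 j (Fin.lt_def.2 (by omega)) m).symm
  · refine le_of_tendsto' (ht e) fun n => ?_
    have := (hrounds n).2.2.2 e
    have hp : 0 ≤ ((i.val + 1 : ℕ) : ℝ) * ((r ^ 2) ^ n * Y) := by positivity
    linarith

theorem exhausts [Fintype E] (T : N.Tower k C) {r : ℝ} (hr0 : 0 < r) (hr : r ^ 2 = 1 - r)
    {n : ℕ} (hn : n ≤ k) : T.Exhausts r n := by
  induction n with
  | zero =>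
    intro f Y _ _ _ _ _
    simp [towerLength]
  | succ n ih => exact T.exhausts_succ (i := ⟨n, hn⟩) hr0 hr (ih (by omega))

end Tower
end Network

/-! ### A concrete network with 18 arcs per level -/

namespace Network

/-- The vertices of the tower network: the source, the sink, the ends of the arcs of the levels, and
further vertices that adjust the number of arcs. -/
inductive TowerVertex (k q : ℕ) : Type
  | source : TowerVertex k q
  | sink : TowerVertex k q
  | tail : Fin k → Fin 3 → TowerVertex k q
  | head : Fin k → Fin 3 → TowerVertex k q
  | pad : Fin q → TowerVertex k q

/-- The arcs of the tower network. -/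
inductive TowerArc (k q : ℕ) : Type
  | level : Fin k → Fin 3 → TowerArc k q
  | enter : Fin k → Fin 3 → TowerArc k q
  | leave : Fin k → Fin 3 → TowerArc k q
  | across : Fin k → Fin 3 → TowerArc k q
  | back : Fin k → Fin 3 → TowerArc k q
  | down : Fin k → Fin 3 → TowerArc k q
  | pad : Option (Fin q) → TowerArc k q

instance (k q : ℕ) : Finite (TowerVertex k q) :=
  Finite.of_injective (β := Bool ⊕ (Bool × Fin k × Fin 3) ⊕ Fin q)
    (fun
      | .source => .inl true
      | .sink => .inl false
      | .tail i j => .inr (.inl (true, i, j))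
      | .head i j => .inr (.inl (false, i, j))
      | .pad m => .inr (.inr m))
    (fun a b h => by cases a <;> cases b <;> simp_all)

namespace TowerArc

variable {k q : ℕ}

/-- The arcs as a sum type. -/
def equivSum (k q : ℕ) : TowerArc k q ≃ (Fin 6 × Fin k × Fin 3) ⊕ Option (Fin q) where
  toFun
    | level i j => .inl (0, i, j)
    | enter i j => .inl (1, i, j)
    | leave i j => .inl (2, i, j)
    | across i j => .inl (3, i, j)
    | back i j => .inl (4, i, j)
    | down i j => .inl (5, i, j)
    | pad m => .inr m
  invFun
    | .inl (0, i, j) => level i j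
    | .inl (1, i, j) => enter i j
    | .inl (2, i, j) => leave i j
    | .inl (3, i, j) => across i j
    | .inl (4, i, j) => back i j
    | .inl (5, i, j) => down i j
    | .inr m => pad m
  left_inv a := by cases a <;> rfl
  right_inv := by
    rintro (⟨c, i, j⟩ | m)
    · fin_cases c <;> rfl
    · rfl

/-- The vertex at the bottom of a descent from level `i`. -/
def below : Fin k → Fin 3 → TowerVertex k q
  | ⟨0, _⟩, _ => .sink
  | ⟨n + 1, h⟩, j => .tail ⟨n, by omega⟩ j

theorem below_ne_head (i i' : Fin k) (j j' : Fin 3) :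
    (below i j : TowerVertex k q) ≠ .head i' j' := by
  rcases i with ⟨_ | n, h⟩ <;> simp [below]

theorem tail_ne_below (i : Fin k) (j j' : Fin 3) :
    TowerVertex.tail i j ≠ (below i j' : TowerVertex k q) := by
  rcases i with ⟨_ | n, h⟩ <;> simp [below]

/-- The start of an arc. -/
def src : TowerArc k q → TowerVertex k q
  | level i j => .tail i j
  | enter _ _ => .source
  | leave i j => .head i j
  | across i j => .head i j
  | back i j => .tail i j
  | down i j => .tail i j
  | pad _ => .source

/-- The end of an arc. -/
def dst : TowerArc k q → TowerVertex k q
  | level i j => .head i j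
  | enter i j => .tail i j
  | leave _ _ => .sink
  | across i j => .head i (j + 1)
  | back i j => .head i (j + 1)
  | down i j => below i (j + 1)
  | pad none => .sink
  | pad (some m) => .pad m

/-- The delicate pairs are `level` and `back`, both leading from tails to heads of one level; the
shift j + 1 ≠ j separates them. -/
theorem simple : Function.Injective fun a : TowerArc k q => (a.src, a.dst) := by
  rintro (_ | _ | _ | _ | _ | _ | (_ | _)) (_ | _ | _ | _ | _ | _ | (_ | _)) h <;>
    simp_all [src, dst, below_ne_head, (below_ne_head _ _ _ _).symm]
  · obtain ⟨⟨_, rfl⟩, _, h⟩ := h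
    exact (fin_three_add_ne _).1 h.symm
  · obtain ⟨⟨_, rfl⟩, _, h⟩ := h
    exact (fin_three_add_ne _).1 h

theorem loopless (a : TowerArc k q) : a.src ≠ a.dst := by
  rcases a with (_ | _ | _ | _ | _ | _ | (_ | _)) <;> simp [src, dst, tail_ne_below]

end TowerArc

open TowerArc

variable {k q : ℕ} {E : Type*}

/-- The tower network with `k` levels, its arcs labelled by `E`. All capacities are `k + 4`. -/
def towerNetwork (ε : TowerArc k q ≃ E) : Network (TowerVertex k q) E where
  src e := (ε.symm e).src
  dst e := (ε.symm e).dst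
  simple := TowerArc.simple.comp ε.symm.injective
  loopless e := (ε.symm e).loopless
  s := .source
  t := .sink
  s_ne_t := by simp
  cap _ := k + 4
  cap_nonneg _ := by positivity

/-- The last steps of the path that operates on level `i`. -/
def descent (ε : TowerArc k q ≃ E) : Fin k → Fin 3 → List (E × Bool)
  | ⟨0, _⟩, _ => []
  | ⟨n + 1, h⟩, z => [(ε (level ⟨n, by omega⟩ z), true), (ε (leave ⟨n, by omega⟩ z), true)]

/-- The path that operates on level `i`. -/
def operation (ε : TowerArc k q ≃ E) (i : Fin k) (z : Fin 3) : List (E × Bool) :=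
  [(ε (enter i z), true), (ε (level i z), true), (ε (across i z), true),
    (ε (level i (z + 1)), false), (ε (back i (z + 1)), true), (ε (level i (z + 2)), false),
    (ε (down i (z + 2)), true)] ++ descent ε i z

/-- The route is source, tail z, head z, head z+1, tail z+1, head z+2, tail z+2. Since z + 3 = z in
`Fin 3`, the arc `down` then leads to arc z of the next level, or to the sink from level 0. -/
theorem isPath_operation (ε : TowerArc k q ≃ E) (i : Fin k) (z : Fin 3) :
    (towerNetwork ε).IsPath (towerNetwork ε).s (operation ε i z) (towerNetwork ε).t := by
  obtain ⟨_ | n, h⟩ := i <;> fin_cases z <;>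
    simp [IsPath, IsWalk, operation, descent, towerNetwork, stepStart, stepEnd, TowerArc.src, TowerArc.dst, below]

theorem mem_operation_false (ε : TowerArc k q ≃ E) (i : Fin k) (z : Fin 3) (e : E) :
    (e, false) ∈ operation ε i z ↔ ∃ j, j ≠ z ∧ e = ε (level i j) := by
  obtain ⟨_ | n, h⟩ := i <;> fin_cases z <;>
    simp [operation, descent, Fin.exists_fin_succ]
  all_goals exact or_comm

theorem pathSign_operation_same (ε : TowerArc k q ≃ E) (i : Fin k) (z j : Fin 3) :
    pathSign (operation ε i z) (ε (level i j)) = if j = z then 1 else -1 := by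
  obtain ⟨_ | n, h⟩ := i <;> fin_cases z <;> fin_cases j <;>
    simp [pathSign, operation, descent]

theorem pathSign_operation_below (ε : TowerArc k q ≃ E) (i : Fin k) (z : Fin 3) (i' : Fin k)
    (j : Fin 3) (h' : i'.val + 1 = i.val) :
    pathSign (operation ε i z) (ε (level i' j)) = if j = z then 1 else 0 := by
  obtain ⟨_ | n, h⟩ := i
  · simp at h'
  · obtain ⟨i', hi'⟩ := i'
    obtain rfl : i' = n := by simpa using h'
    simp [pathSign, operation, descent]

theorem pathSign_operation_other (ε : TowerArc k q ≃ E) (i : Fin k) (z : Fin 3) (i' : Fin k)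
    (j : Fin 3) (hne : i' ≠ i) (h' : i'.val + 1 ≠ i.val) :
    pathSign (operation ε i z) (ε (level i' j)) = 0 := by
  obtain ⟨_ | n, h⟩ := i
  · simp [pathSign, operation, descent, hne]
  · have : i' ≠ ⟨n, by omega⟩ := fun hi => h' (by simp [hi])
    simp [pathSign, operation, descent, hne, this]

/-- The levels of the tower network. -/
def towerNetworkTower (ε : TowerArc k q ≃ E) : (towerNetwork ε).Tower k (k + 4) where
  cap_eq _ := rfl
  arc i j := ε (level i j)
  op := operation ε
  isPath := isPath_operation ε
  mem_backward := mem_operation_false ε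
  pathSign_same := pathSign_operation_same ε
  pathSign_below := pathSign_operation_below ε
  pathSign_other := pathSign_operation_other ε

open Classical in
/-- The flow that sends `w j` through the arc `j` of level `i`. -/
noncomputable def levelFlow (ε : TowerArc k q ≃ E) (i : Fin k) (w : Fin 3 → ℝ) (e : E) : ℝ :=
  ∑ j, w j * ((if e = ε (enter i j) then 1 else 0) + (if e = ε (level i j) then 1 else 0) +
    (if e = ε (leave i j) then 1 else 0))

theorem levelFlow_level (ε : TowerArc k q ≃ E) (i : Fin k) (w : Fin 3 → ℝ) (i' : Fin k)
    (j : Fin 3) : levelFlow ε i w (ε (level i' j)) = if i' = i then w j else 0 := by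
  by_cases h : i' = i <;> simp [levelFlow, h]

theorem levelFlow_nonneg (ε : TowerArc k q ≃ E) (i : Fin k) {w : Fin 3 → ℝ} (hw : ∀ j, 0 ≤ w j)
    (e : E) : 0 ≤ levelFlow ε i w e :=
  Finset.sum_nonneg fun j _ => mul_nonneg (hw j) (by positivity)

/-- The crude factor 3 avoids checking that the three indicators exclude each other. -/
theorem levelFlow_le (ε : TowerArc k q ≃ E) (i : Fin k) {w : Fin 3 → ℝ} (hw : ∀ j, 0 ≤ w j)
    (e : E) : levelFlow ε i w e ≤ 3 * ∑ j, w j := by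
  rw [Finset.mul_sum]
  refine Finset.sum_le_sum fun j _ => ?_
  rw [mul_comm]
  refine mul_le_mul_of_nonneg_right ?_ (hw j)
  split_ifs <;> norm_num

theorem isFlow_levelFlow [Fintype E] (ε : TowerArc k q ≃ E) (i : Fin k) {w : Fin 3 → ℝ}
    (hw : ∀ j, 0 ≤ w j) (hsum : ∑ j, w j ≤ 1) : (towerNetwork ε).IsFlow (levelFlow ε i w) where
  nonneg := levelFlow_nonneg ε i hw
  le_cap e := by
    have h1 := levelFlow_le ε i hw e
    have h2 : (0 : ℝ) ≤ k := Nat.cast_nonneg k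
    change _ ≤ (k : ℝ) + 4
    linarith
  conserved u hs ht := by
    classical
    have hs' : TowerVertex.source ≠ u := fun h => hs h.symm
    have ht' : TowerVertex.sink ≠ u := fun h => ht h.symm
    simp only [levelFlow]
    -- Exchanging the sums reduces conservation to the single paths source, tail j, head j, sink.
    refine Finset.sum_comm.trans (Eq.trans ?_ Finset.sum_comm.symm)
    refine Finset.sum_congr rfl fun j _ => ?_
    rw [← Finset.mul_sum, ← Finset.mul_sum]
    congr 1
    simp only [Finset.sum_add_distrib, Finset.sum_ite_eq', Finset.mem_filter, Finset.mem_univ,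
      true_and]
    simp [towerNetwork, TowerArc.src, TowerArc.dst, hs', ht']

theorem exists_loaded_flow [Fintype E] (ε : TowerArc k q ≃ E) {r : ℝ} (hr0 : 0 < r)
    (hr : r ^ 2 = 1 - r) : ∃ f, (towerNetwork ε).IsFlow f ∧ (∀ e, f e ≤ 3) ∧
      (∀ j : Fin k, j.val + 1 = k → ∃ z l s, (towerNetworkTower ε).Loaded r f j z l s 1) ∧
      ∀ j : Fin k, j.val + 1 < k → ∀ m, f ((towerNetworkTower ε).arc j m) = 0 := by
  rcases Nat.eq_zero_or_pos k with rfl | hk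
  · exact ⟨0, ⟨fun _ => le_rfl, (towerNetwork ε).cap_nonneg, fun _ _ _ => by simp⟩,
      fun _ => by simp, fun j => j.elim0, fun j => j.elim0⟩
  · have hw : ∀ j, 0 ≤ (![0, r, r ^ 2] : Fin 3 → ℝ) j := fun j => by
      fin_cases j <;> simp [hr0.le]
    have hsum : ∑ j, (![0, r, r ^ 2] : Fin 3 → ℝ) j = 1 := by
      simp [Fin.sum_univ_three, hr]
    refine ⟨levelFlow ε ⟨k - 1, by omega⟩ ![0, r, r ^ 2], isFlow_levelFlow ε _ hw hsum.le,
      fun e => ?_, fun j hj => ⟨0, 1, 2, by decide, by decide, by decide, ?_, ?_, ?_⟩,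
      fun j hj m => ?_⟩
    · simpa [hsum] using levelFlow_le ε ⟨k - 1, by omega⟩ hw e
    · simp [towerNetworkTower, levelFlow_level]
    · simp only [towerNetworkTower, levelFlow_level]
      rw [if_pos (Fin.ext (by simp; omega))]
      simp
    · simp only [towerNetworkTower, levelFlow_level]
      rw [if_pos (Fin.ext (by simp; omega))]
      simp
    · simp only [towerNetworkTower, levelFlow_level]
      rw [if_neg (fun h => by have := congrArg Fin.val h; simp at this; omega)]

theorem exists_run_towerNetwork [Fintype E] (ε : TowerArc k q ≃ E) :
    ∃ (R : (towerNetwork ε).Run) (τ : Ordinal.{0}), R.IsRunTime τ ∧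
      ω ^ (k : Ordinal.{0}) ≤ τ := by
  obtain ⟨r, hr0, hr⟩ : ∃ r : ℝ, 0 < r ∧ r ^ 2 = 1 - r := by
    refine ⟨(√5 - 1) / 2, ?_, ?_⟩
    · have : 1 < √5 := Real.lt_sqrt_of_sq_lt (by norm_num)
      linarith
    · have : √5 ^ 2 = 5 := Real.sq_sqrt (by norm_num)
      linear_combination this / 4
  obtain ⟨f, hf, hf3, hload, hlow⟩ := exists_loaded_flow ε hr0 hr
  let T := towerNetworkTower ε
  obtain ⟨-, -, hg⟩ := T.exhausts hr0 hr le_rfl f 1 hf.respectsCap one_pos hload hlow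
    (fun e => by linarith [hf3 e])
  -- The direct arc carries at most 3 + k, less than its capacity k + 4, so the run is still going
  -- after `towerLength k` steps.
  have haug : (towerNetwork ε).IsAugmenting
      ((towerNetwork ε).iterFlow T.strategy f (towerLength k)) [(ε (pad none), true)] := by
    refine ⟨by simp [IsPath, IsWalk, towerNetwork, stepStart, stepEnd, TowerArc.src, TowerArc.dst], fun p hp => ?_⟩
    rw [List.mem_singleton.1 hp]
    have h1 := hg (ε (pad none))
    have h2 := hf3 (ε (pad none))
    simp only [residual, if_true, towerNetwork] at h1 ⊢
    linarith
  obtain ⟨τ, hτ, hlt⟩ := exists_isRunTime_gt T.isChoice_strategy hf (T.strategy_ne_none haug)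
  exact ⟨_, τ, hτ, opow_le_of_towerLength_lt hlt⟩

end Network

theorem mainTheorem3 (ℓ : ℕ) (hℓ : 0 < ℓ) :
    ∃ (V : Type) (_ : Finite V) (N : Network V (Fin ℓ)) (R : N.Run) (τ : Ordinal.{0}),
      R.IsRunTime τ ∧ ω ^ ((ℓ / 25 : ℕ) : Ordinal.{0}) ≤ τ := by
  -- With k = ℓ / 25 there are 18k level arcs and one direct arc; dead-end arcs at the source supply
  -- the rest. The natural subtraction is exact because 25k ≤ ℓ and ℓ > 0 give 18k + 1 ≤ ℓ.
  have hcard : Fintype.card ((Fin 6 × Fin (ℓ / 25) × Fin 3) ⊕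
      Option (Fin (ℓ - 18 * (ℓ / 25) - 1))) = ℓ := by
    simp only [Fintype.card_sum, Fintype.card_prod, Fintype.card_fin, Fintype.card_option]
    omega
  obtain ⟨R, τ, h⟩ := Network.exists_run_towerNetwork
    ((Network.TowerArc.equivSum (ℓ / 25) (ℓ - 18 * (ℓ / 25) - 1)).trans
      (Fintype.equivFinOfCardEq hcard))
  exact ⟨_, inferInstance, _, R, τ, h⟩
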